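/- Let $\mathscr{A}$ be a complex Banach $^*$-algebra, not necessarily unital and with a not necessarily continuous involution (i.e. a $^*$-algebra with a complete submultiplicative norm), and let $\overline{\mathscr{A}}'$ be its antidual, i.e. the Banach space of continuous conjugate-linear functionals $\varphi:\mathscr{A}\to\mathbb{C}$, with pairing $\langle \varphi,x\rangle=\varphi(x)$. For $\varphi\in\overline{\mathscr{A}}'$ let $\overline{\varphi}\in\mathscr{A}'$ be the functional $x\mapsto\overline{\varphi(x)}$. Let $\mathscr{M}\subseteq\mathscr{A}$ be a left ideal (a linear subspace with $xa\in\mathscr{M}$ for $x\in\mathscr{A}$, $a\in\mathscr{M}$) and let $f:\mathscr{M}\to\mathbb{C}$ be a linear functional such that, for some constant $C\ge 0$, $$|f(a)|^2\le C\, f(a^*a)\qquad\text{for all } a\in\mathscr{M},$$ where the inequality includes that the right-hand side is real. Assume further that there is a norm bounded net $(e_i)_{i\in I}$ in $\mathscr{A}$ with $\lim_i e_i a=a$ in norm for all $a\in\mathscr{M}$. Then: (1) For each $a\in\mathscr{M}$ the functional $Aa: x\mapsto f(x^*a)$ on $\mathscr{A}$ is continuous, so that $A:\mathscr{M}\to\overline{\mathscr{A}}'$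 is a well-defined linear operator. It has a unique Krein--von Neumann extension $A_N$, that is, a smallest bounded positive extension: $A_N:\mathscr{A}\to\overline{\mathscr{A}}'$ is bounded and linear, $\langle A_Nx,x\rangle\ge0$ for all $x\in\mathscr{A}$, $A_N$ extends $A$, and $\langle A_Nx,x\rangle\le\langle Bx,x\rangle$ for all $x\in\mathscr{A}$ and every bounded linear operator $B:\mathscr{A}\to\overline{\mathscr{A}}'$ that extends $A$ and satisfies $\langle By,y\rangle\ge 0$ for all $y\in\mathscr{A}$. (2) $f$ has a unique minimal representable extension $f_N$. Here a functional $g\in\mathscr{A}'$ with $g(x^*x)\ge 0$ for all $x\in\mathscr{A}$ is called representable if there are a $^*$-representation $\pi$ of $\mathscr{A}$ by bounded operators on a complex Hilbert space and a vector $\zeta$ in that space with $g(x)=(\pi(x)\zeta\,|\,\zeta)$ for all $x\in\mathscr{A}$; and $f_N$ is minimal in the sense that it is a representable extension of $f$ and $f_N(x^*x)\le g(x^*x)$ for all $x\in\mathscr{A}$ and every representable extension $g\in\mathscr{A}'$ of $f$. (3) The net $(A_Ne_i)_{i\in I}$ converges in the norm of $\overline{\mathscr{A}}'$, the conjugate of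 its limit is $f_N$, and $$f_N=\lim_{i}\overline{A_Ne_i}$$ in the norm of $\mathscr{A}'$. -/

import Mathlib

open Filter Topology
open scoped ComplexOrder

universe u

/- Inequalities between complex numbers are meant in the usual partial order of `ℂ`:
`z ≤ w` says that `w - z` is a nonnegative real number. -/

section Operators

variable {E : Type*} [NormedAddCommGroup E] [NormedSpace ℂ E]

variable (E) in
/-- The antidual of `E`: the continuous conjugate-linear functionals on `E`, with the functional
norm. The pairing of `φ` and `x` is the value `φ x`. -/
abbrev AntiDual : Type _ := E →L⋆[ℂ] ℂ

/-- The conjugate `x ↦ conj (φ x)` of a functional in the antidual, an element of the dual. -/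
noncomputable def AntiDual.conj (φ : AntiDual E) : StrongDual ℂ E :=
  ((starL ℂ : ℂ ≃L⋆[ℂ] ℂ) : ℂ →L⋆[ℂ] ℂ).comp φ

theorem AntiDual.conj_apply (φ : AntiDual E) (x : E) : φ.conj x = star (φ x) := rfl

/-- Positivity of an everywhere defined bounded operator from `E` into its antidual. -/
def IsPositiveOp (B : E →L[ℂ] AntiDual E) : Prop :=
  ∀ x : E, 0 ≤ B x x

/-- `B` is a bounded positive extension to `E` of the operator `A` with domain `D`. -/
def IsPositiveExtension {D : Submodule ℂ E} (A : D →ₗ[ℂ] AntiDual E)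
    (B : E →L[ℂ] AntiDual E) : Prop :=
  IsPositiveOp B ∧ ∀ a : D, B (a : E) = A a

/-- `B` is the Krein-von Neumann extension of `A`: the smallest bounded positive extension of `A`
to `E`, where `B ≤ B'` means that `B x x ≤ B' x x` for all `x`. -/
def IsKreinVonNeumannExtension {D : Submodule ℂ E} (A : D →ₗ[ℂ] AntiDual E)
    (B : E →L[ℂ] AntiDual E) : Prop :=
  IsPositiveExtension A B ∧
    ∀ B' : E →L[ℂ] AntiDual E, IsPositiveExtension A B' → ∀ x : E, B x x ≤ B' x x

end Operators

section Functionals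

variable {𝔄 : Type u} [NonUnitalNormedRing 𝔄] [NormedSpace ℂ 𝔄]

/-- A linear subspace that is a left ideal of the (not necessarily unital) algebra. -/
def IsLeftIdeal (M : Submodule ℂ 𝔄) : Prop :=
  ∀ x : 𝔄, ∀ a ∈ M, x * a ∈ M

variable [StarRing 𝔄] [StarModule ℂ 𝔄]

/-- The operator `a ↦ (x ↦ f (x* a))` from the left ideal `M` into the antidual of the algebra,
for a linear functional `f` on `M` such that each functional `x ↦ f (x* a)` is continuous. -/
def inducedOperator [IsScalarTower ℂ 𝔄 𝔄] [SMulCommClass ℂ 𝔄 𝔄]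
    {M : Submodule ℂ 𝔄} (hM : IsLeftIdeal M) (f : M →ₗ[ℂ] ℂ)
    (hf : ∀ a : M, Continuous fun x : 𝔄 => f ⟨star x * a, hM (star x) a a.2⟩) :
    M →ₗ[ℂ] AntiDual 𝔄 where
  toFun a :=
    { toFun := fun x => f ⟨star x * a, hM (star x) a a.2⟩
      map_add' := fun x y => by
        rw [← map_add]; congr 1; ext; simp [add_mul]
      map_smul' := fun c x => by
        rw [← map_smul]; congr 1; ext; simp [smul_mul_assoc]
      cont := hf a }
  map_add' a b := by
    ext x
    change f _ = f _ + f _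
    rw [← map_add]; congr 1; ext; simp [mul_add]
  map_smul' c a := by
    ext x
    change f _ = c • f _
    rw [← map_smul]; congr 1; ext; simp [mul_smul_comm]

/-- A continuous positive functional `g` on the algebra is representable if
`g x = (π x ζ | ζ)` for some star-representation `π` by bounded operators on a complex Hilbert
space and some vector `ζ`. (Mathlib's inner product is linear in the second variable. Hilbert
spaces in the universe of the algebra suffice, since `π` and `ζ` can be compressed to the closure
of `{π x ζ}`, which is isometric to a completion of a quotient of the algebra.) -/
def IsRepresentable (g : StrongDual ℂ 𝔄) : Prop :=
  (∀ x : 𝔄, 0 ≤ g (star x * x)) ∧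
    ∃ (H : Type u) (_ : NormedAddCommGroup H) (_ : InnerProductSpace ℂ H) (_ : CompleteSpace H)
      (π : 𝔄 →⋆ₙₐ[ℂ] (H →L[ℂ] H)) (ζ : H), ∀ x : 𝔄, g x = inner ℂ ζ (π x ζ)

/-- `g` is a representable positive functional on the whole algebra extending `f`. -/
def IsRepresentableExtension {M : Submodule ℂ 𝔄} (f : M →ₗ[ℂ] ℂ) (g : StrongDual ℂ 𝔄) : Prop :=
  IsRepresentable g ∧ ∀ a : M, g (a : 𝔄) = f a

/-- `g` is the minimal representable extension of `f`. -/
def IsMinimalRepresentableExtension {M : Submodule ℂ 𝔄} (f : M →ₗ[ℂ] ℂ)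
    (g : StrongDual ℂ 𝔄) : Prop :=
  IsRepresentableExtension f g ∧
    ∀ g' : StrongDual ℂ 𝔄, IsRepresentableExtension f g' →
      ∀ x : 𝔄, g (star x * x) ≤ g' (star x * x)

end Functionals

/-! Completing `M` for the semi-inner product `⟨a, b⟩ = f (a* b)` gives a Hilbert space `H` on which
`𝔄` acts by left multiplication `π`; these operators are bounded because Ford's square root lemma
makes a small multiple of `x* x` equal to `1 - (1 - u)²` with `u` self-adjoint. The bound
`|f a|² ≤ C f (a* a)` provides a vector `ζ` with `f a = ⟪ζ, π a ζ⟫` and `π(M)ζ` dense. By automatic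
continuity of `π` the map `V x = π x ζ` is bounded, and then `A_N = V† V`, whose minimality is the
Cauchy–Schwarz inequality for a positive extension combined with the density of `V(M)`. A
representable extension of `f` induces a positive extension of `A`, so `f_N x = ⟪ζ, π x ζ⟫` inherits
this minimality; it is unique because a representable functional is determined by its values at the
elements `x* x`. Finally `π (e i) ζ → ζ`, hence `A_N (e i) = V† (π (e i) ζ) → V† ζ`, which is the
conjugate of `f_N`. -/

section SquareRoot

theorem eventually_norm_pow_le_one {B : Type*} [NormedRing B] [NormedAlgebra ℂ B]
    [CompleteSpace B] {w : B} (hw : spectralRadius ℂ w < 1) :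
    ∀ᶠ n : ℕ in atTop, ‖w ^ n‖ ≤ 1 := by
  have gelfand := spectrum.pow_nnnorm_pow_one_div_tendsto_nhds_spectralRadius w
  filter_upwards [gelfand.eventually_lt_const hw] with n hn
  contrapose! hn
  have : (1 : ENNReal) ≤ ‖w ^ n‖₊ := by exact_mod_cast hn.le
  simpa using ENNReal.rpow_le_rpow this (z := 1 / n) (by positivity)

/-- The difference `d = u - w` satisfies `d * w = d * (2 - u)`, so that `d * w ^ n` grows like
`(2 - ‖u‖) ^ n` unless `d = 0`. -/
theorem eq_of_commute_of_quasiSq_eq {B : Type*} [NormedRing B] [NormedAlgebra ℂ B]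
    [CompleteSpace B] {u w : B} (hcomm : Commute u w) (hu : ‖u‖ < 1)
    (hw : spectralRadius ℂ w < 1) (h : u + u - u * u = w + w - w * w) : u = w := by
  have hdw : (u - w) * w = (u - w) + (u - w) - (u - w) * u := by
    rw [sub_mul, sub_mul, hcomm.eq]
    linear_combination (norm := abel) -h
  have growth (n : ℕ) : (2 - ‖u‖) ^ n * ‖u - w‖ ≤ ‖(u - w) * w ^ n‖ := by
    induction n with
    | zero => simp
    | succ n ih =>
      set z := (u - w) * w ^ n
      have hz : (u - w) * w ^ (n + 1) = (z + z) - z * u := by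
        rw [pow_succ', ← mul_assoc, hdw, sub_mul, add_mul, mul_assoc _ u,
          (hcomm.pow_right n).eq, ← mul_assoc]
      calc (2 - ‖u‖) ^ (n + 1) * ‖u - w‖ = (2 - ‖u‖) * ((2 - ‖u‖) ^ n * ‖u - w‖) := by ring
        _ ≤ (2 - ‖u‖) * ‖z‖ := by gcongr; linarith
        _ ≤ ‖z + z‖ - ‖z * u‖ := by
          have : ‖z + z‖ = 2 * ‖z‖ := by rw [← two_smul ℂ z, norm_smul, Complex.norm_ofNat]
          linarith [norm_mul_le z u]
        _ ≤ ‖(u - w) * w ^ (n + 1)‖ := hz ▸ norm_sub_norm_le _ _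
  obtain ⟨n, hn, hn1⟩ := ((eventually_norm_pow_le_one hw).and (eventually_ne_atTop 0)).exists
  have h1 : 1 < (2 - ‖u‖) ^ n := one_lt_pow₀ (by linarith) hn1
  have h2 : (2 - ‖u‖) ^ n * ‖u - w‖ ≤ ‖u - w‖ :=
    (growth n).trans ((norm_mul_le _ _).trans (mul_le_of_le_one_right (norm_nonneg _) hn))
  have h3 : ‖u - w‖ = 0 := by nlinarith [norm_nonneg (u - w)]
  exact sub_eq_zero.1 (norm_eq_zero.1 h3)

variable {A : Type*} [NonUnitalNormedRing A] [NormedSpace ℂ A]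
  [IsScalarTower ℂ A A] [SMulCommClass ℂ A A] [CompleteSpace A]

theorem exists_quasiSq_eq {h : A} (hh : ‖h‖ < 1) :
    ∃ u : A, ‖u‖ ≤ ‖h‖ ∧ u + u - u * u = h ∧ ∀ y, Commute h y → Commute u y := by
  let F (u : A) : A := (1 / 2 : ℂ) • (h + u * u)
  let S : Set A := Metric.closedBall 0 ‖h‖ ∩ Set.centralizer (Set.centralizer {h})
  have hS : IsClosed S := Metric.isClosed_closedBall.inter (Set.isClosed_centralizer _)
  have memS {u : A} : u ∈ S ↔ ‖u‖ ≤ ‖h‖ ∧ ∀ y, Commute h y → Commute u y := by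
    simp [S, Set.mem_centralizer_iff, commute_iff_eq, eq_comm]
  have hF (u : A) : ‖F u‖ = 1 / 2 * ‖h + u * u‖ := by norm_num [F, norm_smul, -smul_add]
  have hmaps : Set.MapsTo F S S := by
    intro u hu
    obtain ⟨hun, huc⟩ := memS.1 hu
    refine memS.2 ⟨?_, fun y hy => (hy.add_left ((huc y hy).mul_left (huc y hy))).smul_left _⟩
    have h1 := norm_mul_le u u
    rw [hF]
    nlinarith [norm_add_le h (u * u), norm_nonneg u]
  have hcontr : ContractingWith ‖h‖₊ (hmaps.restrict F S S) := by
    refine ⟨by exact_mod_cast hh, LipschitzWith.of_dist_le_mul ?_⟩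
    rintro ⟨u, hu⟩ ⟨v, hv⟩
    have hu' := (memS.1 hu).1
    have hv' := (memS.1 hv).1
    have hsub : F u - F v = (1 / 2 : ℂ) • (u * (u - v) + (u - v) * v) := by
      simp only [F, ← smul_sub]; congr 1; noncomm_ring
    calc dist (F u) (F v) = 1 / 2 * ‖u * (u - v) + (u - v) * v‖ := by
          rw [dist_eq_norm, hsub, norm_smul]; norm_num
      _ ≤ 1 / 2 * (‖u‖ * ‖u - v‖ + ‖u - v‖ * ‖v‖) := by
          gcongr; exact norm_add_le_of_le (norm_mul_le _ _) (norm_mul_le _ _)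
      _ ≤ 1 / 2 * (‖h‖ * ‖u - v‖ + ‖u - v‖ * ‖h‖) := by gcongr
      _ = ‖h‖ * dist u v := by rw [dist_eq_norm]; ring
  obtain ⟨u, hu, hfix, -⟩ := hcontr.exists_fixedPoint' hS.isComplete hmaps
    (x := 0) (memS.2 ⟨by simp, fun y _ => Commute.zero_left y⟩) (edist_ne_top _ _)
  refine ⟨u, (memS.1 hu).1, ?_, (memS.1 hu).2⟩
  have hfix' : (1 / 2 : ℂ) • (h + u * u) = u := hfix
  have : u + u = h + u * u := by
    rw [← two_smul ℂ u, ← hfix', smul_smul]; norm_num [hfix']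
  rw [this, add_sub_cancel_right]

/-- The isometric embedding of `A` into its unitization with the `ℓ¹` norm. -/
noncomputable def inrL1 (A : Type*) [NonUnitalNormedRing A] [NormedSpace ℂ A]
    [IsScalarTower ℂ A A] [SMulCommClass ℂ A A] : A →ₙₐ[ℂ] WithLp 1 (Unitization ℂ A) :=
  ((WithLp.unitizationAlgEquiv (𝕜 := ℂ) (A := A) ℂ).symm : _ →ₙₐ[ℂ] _).comp
    (Unitization.inrNonUnitalAlgHom ℂ A)

omit [CompleteSpace A] in
theorem norm_inrL1 (x : A) : ‖inrL1 A x‖ = ‖x‖ := WithLp.unitization_norm_inr x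

omit [CompleteSpace A] in
theorem spectrum_inrL1 (x : A) : spectrum ℂ (inrL1 A x) = quasispectrum ℂ x := by
  rw [Unitization.quasispectrum_eq_spectrum_inr]
  exact AlgEquiv.spectrum_eq (WithLp.unitizationAlgEquiv (𝕜 := ℂ) (A := A) ℂ).symm _

theorem norm_le_of_mem_quasispectrum {x : A} {k : ℂ} (hk : k ∈ quasispectrum ℂ x) :
    ‖k‖ ≤ ‖x‖ := by
  have norm_one : ‖(1 : WithLp 1 (Unitization ℂ A))‖ = 1 := by
    rw [WithLp.unitization_norm_def]
    change ‖(1 : Unitization ℂ A).fst‖ + ‖(1 : Unitization ℂ A).snd‖ = 1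
    simp
  rw [← spectrum_inrL1] at hk
  simpa [norm_one, norm_inrL1] using spectrum.norm_le_norm_mul_of_mem hk

variable [StarRing A] [StarModule ℂ A]

omit [CompleteSpace A] in
theorem star_mem_quasispectrum_star_iff {x : A} {k : ℂ} :
    star k ∈ quasispectrum ℂ (star x) ↔ k ∈ quasispectrum ℂ x := by
  rw [Unitization.quasispectrum_eq_spectrum_inr, Unitization.quasispectrum_eq_spectrum_inr,
    Unitization.inr_star, spectrum.map_star, Set.star_mem_star]

theorem spectralRadius_inrL1_star_le (x : A) : spectralRadius ℂ (inrL1 A (star x)) ≤ ‖x‖₊ := by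
  refine iSup₂_le fun k hk => ?_
  rw [spectrum_inrL1, ← star_star k, star_mem_quasispectrum_star_iff] at hk
  exact_mod_cast norm_star k ▸ norm_le_of_mem_quasispectrum hk

/-- **Ford's square root lemma**: `1 - h = (1 - u) ^ 2`, written without a unit. -/
theorem exists_isSelfAdjoint_quasiSq_eq {h : A} (hsa : IsSelfAdjoint h) (hh : ‖h‖ < 1) :
    ∃ u : A, IsSelfAdjoint u ∧ u + u - u * u = h := by
  obtain ⟨u, hun, huh, hcomm⟩ := exists_quasiSq_eq hh
  have hsuh : star u + star u - star u * star u = h := by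
    rw [← hsa.star_eq, ← huh]; simp
  have hcu : Commute u (star u) := hcomm _ <| hsuh ▸
    ((Commute.refl _).add_left (Commute.refl _)).sub_left
      ((Commute.refl _).mul_left (Commute.refl _))
  have heq : inrL1 A u = inrL1 A (star u) := by
    refine eq_of_commute_of_quasiSq_eq (hcu.map (inrL1 A)) ?_ ?_ ?_
    · exact (norm_inrL1 u).trans_lt (hun.trans_lt hh)
    · exact (spectralRadius_inrL1_star_le u).trans_lt (by exact_mod_cast hun.trans_lt hh)
    · simp only [← map_add, ← map_mul, ← map_sub, huh, hsuh]
  refine ⟨u, ?_, huh⟩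
  rw [isSelfAdjoint_iff, ← sub_eq_zero, ← norm_eq_zero, ← norm_inrL1, map_sub, heq, sub_self,
    norm_zero]

end SquareRoot

section AutomaticContinuity

theorem norm_sq_le_norm_mul_self_add_mul_self {D : Type*} [CStarAlgebra D] [PartialOrder D]
    [StarOrderedRing D] {p q : D} (hp : IsSelfAdjoint p) (hq : IsSelfAdjoint q) :
    ‖q‖ ^ 2 ≤ ‖p * p + q * q‖ := by
  have mul_self_nonneg' {r : D} (hr : IsSelfAdjoint r) : 0 ≤ r * r := by
    simpa only [hr.star_eq] using star_mul_self_nonneg r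
  rw [← hq.norm_mul_self]
  exact CStarAlgebra.norm_le_norm_of_nonneg_of_le (mul_self_nonneg' hq)
    (le_add_of_nonneg_left (mul_self_nonneg' hp))

variable {A : Type*} [NonUnitalNormedRing A] [NormedSpace ℂ A]
  [IsScalarTower ℂ A A] [SMulCommClass ℂ A A] [CompleteSpace A] [StarRing A]
  {D : Type*} [CStarAlgebra D] (π : A →⋆ₙₐ[ℂ] D)

theorem norm_map_le_of_isSelfAdjoint_map {s : A} (hs : IsSelfAdjoint (π s)) : ‖π s‖ ≤ ‖s‖ := by
  have : spectralRadius ℂ (π s) ≤ ‖s‖₊ := iSup₂_le fun k hk => by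
    exact_mod_cast norm_le_of_mem_quasispectrum
      (NonUnitalAlgHom.quasispectrum_apply_subset π s (spectrum_subset_quasispectrum ℂ _ hk))
  rw [hs.spectralRadius_eq_nnnorm] at this
  exact_mod_cast this

variable [StarModule ℂ A] [PartialOrder D] [StarOrderedRing D]

/-- If `s = b + i c` with `b`, `c` self-adjoint is the limit of `x n`, then
`(x n - b) ^ 2 + c ^ 2 → 0`, although `π` maps both terms to positive elements. -/
theorem isClosed_setOf_isSelfAdjoint_map : IsClosed {s : A | IsSelfAdjoint (π s)} := by
  refine IsSeqClosed.isClosed fun x s hx hlim => ?_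
  set b : A := (realPart s : A)
  set c : A := (imaginaryPart s : A)
  have hs : b + Complex.I • c = s := realPart_add_I_smul_imaginaryPart s
  have hb : IsSelfAdjoint (π b) := (realPart s).2.map π
  have hc : IsSelfAdjoint (π c) := (imaginaryPart s).2.map π
  have hsub : Tendsto (fun n => x n - b) atTop (𝓝 (Complex.I • c)) := by
    simpa only [← hs, add_sub_cancel_left] using hlim.sub_const b
  have hzero : Tendsto (fun n => ‖(x n - b) * (x n - b) + c * c‖) atTop (𝓝 0) := by
    simpa [smul_mul_smul_comm] using ((hsub.mul hsub).add_const (c * c)).norm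
  have hle (n : ℕ) : ‖π c‖ ^ 2 ≤ ‖(x n - b) * (x n - b) + c * c‖ := by
    have hxb : IsSelfAdjoint (π (x n - b)) := by
      rw [map_sub]; exact IsSelfAdjoint.sub (hx n) hb
    have hsum : IsSelfAdjoint (π ((x n - b) * (x n - b) + c * c)) := by
      rw [map_add, map_mul, map_mul]
      exact ((hxb.commute_iff hxb).1 (.refl _)).add ((hc.commute_iff hc).1 (.refl _))
    calc ‖π c‖ ^ 2 ≤ ‖π ((x n - b) * (x n - b) + c * c)‖ := by
          rw [map_add, map_mul, map_mul]
          exact norm_sq_le_norm_mul_self_add_mul_self hxb hc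
      _ ≤ _ := norm_map_le_of_isSelfAdjoint_map π hsum
  have hc0 : π c = 0 := by
    simpa using pow_eq_zero_iff two_ne_zero |>.1
      (le_antisymm (ge_of_tendsto' hzero hle) (sq_nonneg ‖π c‖))
  change IsSelfAdjoint (π s)
  rwa [← hs, map_add, map_smul, hc0, smul_zero, add_zero]

/-- The open mapping theorem applies to `(b, c) ↦ b + i c` on the closed real subspace of elements
with self-adjoint image. -/
theorem continuous_starHom_to_cstarAlgebra : Continuous π := by
  let S : Submodule ℝ A := (selfAdjoint.submodule ℝ D).comap
    ((LinearMapClass.linearMap π : A →ₗ[ℂ] D).restrictScalars ℝ)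
  have hS : IsClosed (S : Set A) := isClosed_setOf_isSelfAdjoint_map π
  have : CompleteSpace S := hS.completeSpace_coe
  let π_S : S →ₗ[ℝ] D := ((LinearMapClass.linearMap π : A →ₗ[ℂ] D).restrictScalars ℝ).comp S.subtype
  have hπ_S : Continuous π_S := AddMonoidHomClass.continuous_of_bound π_S 1 fun s => by
    rw [one_mul]
    exact norm_map_le_of_isSelfAdjoint_map π s.2
  let F : S × S →L[ℝ] A := S.subtypeL.coprod
    (((Complex.I • ContinuousLinearMap.id ℂ A).restrictScalars ℝ).comp S.subtypeL)
  have hF : Function.Surjective F := fun x =>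
    ⟨(⟨realPart x, (realPart x).2.map π⟩, ⟨imaginaryPart x, (imaginaryPart x).2.map π⟩),
      realPart_add_I_smul_imaginaryPart x⟩
  have hπF : π ∘ F = fun p => π_S p.1 + Complex.I • π_S p.2 := by
    ext p
    change π ((p.1 : A) + Complex.I • (p.2 : A)) = _
    rw [map_add, map_smul]
    rfl
  rw [(F.isQuotientMap hF).continuous_iff, hπF]
  fun_prop

end AutomaticContinuity

section SesquilinearForms

variable {V : Type*} [AddCommGroup V] [Module ℂ V] {s t : V →ₗ⋆[ℂ] V →ₗ[ℂ] ℂ}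

theorem sesqForm_conj_symm (hs : ∀ v, 0 ≤ s v v) (v w : V) :
    (starRingEnd ℂ) (s w v) = s v w := by
  have him (v : V) : (s v v).im = 0 := (Complex.nonneg_iff.1 (hs v)).2.symm
  have h1 := him (v + w)
  have h2 := him (v + Complex.I • w)
  simp only [map_add, map_smul, map_smulₛₗ, LinearMap.add_apply, LinearMap.smul_apply, smul_eq_mul,
    Complex.conj_I, neg_mul, Complex.add_im, Complex.neg_im, Complex.I_mul_im, Complex.add_re,
    Complex.neg_re, Complex.I_mul_re, him, neg_zero, add_zero, zero_add] at h1 h2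
  apply Complex.ext
  · rw [Complex.conj_re]; linarith
  · rw [Complex.conj_im]; linarith

/-- The semi-inner product given by a positive semidefinite sesquilinear form; it is passed
explicitly to the results on semi-inner products, so as not to clash with a norm on `V`. -/
abbrev preInnerProductSpaceCore (hs : ∀ v, 0 ≤ s v v) : PreInnerProductSpace.Core ℂ V where
  inner v w := s v w
  conj_inner_symm := sesqForm_conj_symm hs
  re_inner_nonneg v := (Complex.nonneg_iff.1 (hs v)).1
  add_left v w z := by simp
  smul_left v w c := by simp

theorem norm_sesqForm_sq_le (hs : ∀ v, 0 ≤ s v v) (v w : V) :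
    ‖s v w‖ ^ 2 ≤ (s v v).re * (s w w).re := by
  have h : ‖s v w‖ * ‖s w v‖ ≤ (s v v).re * (s w w).re :=
    @InnerProductSpace.Core.inner_mul_inner_self_le ℂ V _ _ _ (preInnerProductSpaceCore hs) v w
  rwa [← sesqForm_conj_symm hs w v, RCLike.norm_conj, ← sq] at h

theorem sesqForm_ext (h : ∀ v, s v v = t v v) : s = t := by
  refine LinearMap.ext₂ fun v w => ?_
  have h1 := h (v + w)
  have h2 := h (v + Complex.I • w)
  simp only [map_add, map_smul, map_smulₛₗ, LinearMap.add_apply, LinearMap.smul_apply, h,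
    Complex.conj_I, smul_eq_mul] at h1 h2
  linear_combination (h1 - Complex.I * h2
    + (s v w - t v w - (s w v - t w v)) * Complex.I_mul_I) / 2

end SesquilinearForms

theorem inner_self_eq_ofReal_norm_sq {V : Type*} [SeminormedAddCommGroup V]
    [InnerProductSpace ℂ V] (v : V) : inner ℂ v v = ((‖v‖ ^ 2 : ℝ) : ℂ) := by
  rw [inner_self_eq_norm_sq_to_K, Complex.ofReal_pow]
  rfl

section AntiDual

variable {E : Type*} [NormedAddCommGroup E] [NormedSpace ℂ E] {B B' : E →L[ℂ] AntiDual E}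

theorem IsPositiveOp.norm_apply_sq_le (hB : IsPositiveOp B) (x y : E) :
    ‖B x y‖ ^ 2 ≤ (B x x).re * (B y y).re := by
  rw [mul_comm]
  exact norm_sesqForm_sq_le (s := B.flip.toLinearMap₁₂) hB y x

theorem operator_ext_of_apply_self (h : ∀ x, B x x = B' x x) : B = B' := by
  ext x y
  exact LinearMap.congr_fun₂
    (sesqForm_ext (s := B.flip.toLinearMap₁₂) (t := B'.flip.toLinearMap₁₂) h) y x

theorem IsKreinVonNeumannExtension.unique {D : Submodule ℂ E} {T : D →ₗ[ℂ] AntiDual E}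
    (hB : IsKreinVonNeumannExtension T B) (hB' : IsKreinVonNeumannExtension T B') : B = B' :=
  operator_ext_of_apply_self fun x => le_antisymm (hB.2 _ hB'.1 x) (hB'.2 _ hB.1 x)

theorem AntiDual.continuous_conj : Continuous (AntiDual.conj : AntiDual E → StrongDual ℂ E) :=
  continuous_id.const_clm_comp _

variable {H : Type*} [NormedAddCommGroup H] [InnerProductSpace ℂ H]

/-- The adjoint `η ↦ (x ↦ ⟪V x, η⟫)` of an operator `V` from `E` into an inner product space, as
an operator into the antidual of `E`. -/
noncomputable def antidualAdjoint (V : E →L[ℂ] H) : H →L[ℂ] AntiDual E :=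
  (innerSLFlip ℂ).bilinearComp (ContinuousLinearMap.id ℂ H) V

theorem antidualAdjoint_apply (V : E →L[ℂ] H) (η : H) (x : E) :
    antidualAdjoint V η x = inner ℂ (V x) η := rfl

theorem isPositiveOp_antidualAdjoint_comp (V : E →L[ℂ] H) :
    IsPositiveOp ((antidualAdjoint V).comp V) := fun x => by
  rw [ContinuousLinearMap.comp_apply, antidualAdjoint_apply, inner_self_eq_ofReal_norm_sq]
  exact Complex.zero_le_real.2 (sq_nonneg _)

/-- On `D` the Cauchy–Schwarz inequality for `B` reads `|⟪V x, V a⟫|² ≤ (B x x) ‖V a‖²`; by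
density `V a` may be replaced by `V x`. -/
theorem inner_apply_self_le_of_isPositiveOp {D : Set E} {V : E →L[ℂ] H} (hV : Dense (V '' D))
    (hB : IsPositiveOp B) (hBV : ∀ a ∈ D, B a = antidualAdjoint V (V a)) (x : E) :
    inner ℂ (V x) (V x) ≤ B x x := by
  have cauchySchwarz (v : H) : ‖inner ℂ (V x) v‖ ^ 2 ≤ (B x x).re * ‖v‖ ^ 2 := by
    induction v using hV.induction with
    | mem v hv =>
      obtain ⟨a, ha, rfl⟩ := hv
      have h := hB.norm_apply_sq_le a x
      rwa [hBV a ha, antidualAdjoint_apply, antidualAdjoint_apply, mul_comm,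
        inner_self_eq_ofReal_norm_sq, Complex.ofReal_re] at h
    | isClosed => exact isClosed_le (by fun_prop) (by fun_prop)
  have hself := cauchySchwarz (V x)
  obtain ⟨hBre, hBim⟩ := Complex.nonneg_iff.1 (hB x)
  rw [inner_self_eq_ofReal_norm_sq, Complex.norm_real, Real.norm_of_nonneg (by positivity)] at hself
  rw [inner_self_eq_ofReal_norm_sq, Complex.le_def, Complex.ofReal_re, Complex.ofReal_im]
  refine ⟨?_, hBim⟩
  rcases (sq_nonneg ‖V x‖).eq_or_lt with h0 | h0
  · rwa [← h0]
  · exact le_of_mul_le_mul_right (by rwa [← sq]) h0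

theorem isKreinVonNeumannExtension_antidualAdjoint_comp {D : Submodule ℂ E}
    {T : D →ₗ[ℂ] AntiDual E} {V : E →L[ℂ] H} (hV : Dense (V '' D))
    (hT : ∀ a : D, T a = antidualAdjoint V (V a)) :
    IsKreinVonNeumannExtension T ((antidualAdjoint V).comp V) :=
  ⟨⟨isPositiveOp_antidualAdjoint_comp V, fun a => (hT a).symm⟩, fun _ hB x =>
    inner_apply_self_le_of_isPositiveOp hV hB.1
      (fun a ha => (hB.2 ⟨a, ha⟩).trans (hT ⟨a, ha⟩)) x⟩

end AntiDual

section PreHilbertRepresentations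

variable {A : Type*} [NonUnitalNormedRing A] [NormedSpace ℂ A]
  [IsScalarTower ℂ A A] [SMulCommClass ℂ A A] [CompleteSpace A] [StarRing A] [StarModule ℂ A]

section SemiInnerProduct

variable {V : Type*} [SeminormedAddCommGroup V] [InnerProductSpace ℂ V]

theorem exists_norm_map_le_of_inner_map_star (T : A →ₙₐ[ℂ] Module.End ℂ V)
    (hT : ∀ x v w, inner ℂ (T (star x) v) w = inner ℂ v (T x w)) (x : A) :
    ∃ K : ℝ, ∀ v, ‖T x v‖ ≤ K * ‖v‖ := by
  set t : ℝ := (‖star x * x‖ + 1)⁻¹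
  have ht : 0 < t := by positivity
  have hsmall : ‖(t : ℂ) • (star x * x)‖ < 1 := by
    rw [norm_smul, Complex.norm_real, Real.norm_of_nonneg ht.le,
      inv_mul_lt_one₀ (by positivity)]
    exact lt_add_one _
  obtain ⟨u, hu, huh⟩ := exists_isSelfAdjoint_quasiSq_eq
    (IsSelfAdjoint.smul (Complex.conj_ofReal t) (.star_mul_self x)) hsmall
  refine ⟨√t⁻¹, fun v => ?_⟩
  have hTu (w w' : V) : inner ℂ (T u w) w' = inner ℂ w (T u w') := by
    simpa only [hu.star_eq] using hT u w w'
  have hTuv : T u v + T u v - T u (T u v) = (t : ℂ) • T (star x) (T x v) := by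
    simpa only [map_sub, map_add, map_mul, map_smul, LinearMap.sub_apply, LinearMap.add_apply,
      LinearMap.smul_apply, Module.End.mul_apply] using LinearMap.congr_fun (congrArg T huh) v
  have key : inner ℂ (v - T u v) (v - T u v) =
      inner ℂ v v - (t : ℂ) * inner ℂ (T x v) (T x v) := by
    calc inner ℂ (v - T u v) (v - T u v)
        = inner ℂ v v - inner ℂ v (T u v + T u v - T u (T u v)) := by
          simp only [inner_sub_left, inner_sub_right, inner_add_right, hTu]; ring
      _ = inner ℂ v v - (t : ℂ) * inner ℂ (T x v) (T x v) := by
          rw [hTuv, inner_smul_right, ← hT (star x), star_star]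
  simp only [inner_self_eq_ofReal_norm_sq] at key
  have key' : ‖v - T u v‖ ^ 2 = ‖v‖ ^ 2 - t * ‖T x v‖ ^ 2 := by exact_mod_cast key
  rw [← Real.sqrt_sq (norm_nonneg v), ← Real.sqrt_mul' _ (sq_nonneg _)]
  refine Real.le_sqrt_of_sq_le ?_
  rw [le_inv_mul_iff₀ ht]
  linarith [sq_nonneg ‖v - T u v‖]

theorem exists_completion_representation (T : A →ₙₐ[ℂ] Module.End ℂ V)
    (hT : ∀ x v w, inner ℂ (T (star x) v) w = inner ℂ v (T x w)) :
    ∃ π : A →⋆ₙₐ[ℂ] (UniformSpace.Completion V →L[ℂ] UniformSpace.Completion V),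
      ∀ x (v : V), π x v = T x v := by
  choose K hK using exists_norm_map_le_of_inner_map_star T hT
  let L (x : A) : UniformSpace.Completion V →L[ℂ] UniformSpace.Completion V :=
    ((T x).mkContinuous (K x) (hK x)).completion
  have hL (x : A) (v : V) : L x v = T x v := ContinuousLinearMap.completion_apply_coe _ v
  have ext {P Q : UniformSpace.Completion V →L[ℂ] UniformSpace.Completion V}
      (h : ∀ v : V, P v = Q v) : P = Q :=
    DFunLike.coe_injective (UniformSpace.Completion.ext P.continuous Q.continuous h)
  refine ⟨
    { toFun := L
      map_smul' := fun c x => ext fun v => by simp [hL, UniformSpace.Completion.coe_smul]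
      map_zero' := ext fun v => by simpa [hL] using UniformSpace.Completion.coe_zero
      map_add' := fun x y => ext fun v => by simp [hL, UniformSpace.Completion.coe_add]
      map_mul' := fun x y => ext fun v => by simp [hL]
      map_star' := fun x => ?_ }, hL⟩
  refine (ContinuousLinearMap.eq_adjoint_iff _ _).2 fun v w => ?_
  induction v, w using UniformSpace.Completion.induction_on₂ with
  | hp => exact isClosed_eq (by fun_prop) (by fun_prop)
  | ih v w => rw [hL, hL, UniformSpace.Completion.inner_coe, UniformSpace.Completion.inner_coe, hT]

theorem exists_eq_inner_completion (φ : V →L[ℂ] ℂ) :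
    ∃ ζ : UniformSpace.Completion V, ∀ v : V, φ v = inner ℂ ζ (v : UniformSpace.Completion V) := by
  refine ⟨(InnerProductSpace.toDual ℂ _).symm (φ.extend UniformSpace.Completion.toComplL),
    fun v => ?_⟩
  rw [InnerProductSpace.toDual_symm_apply]
  exact (ContinuousLinearMap.extend_eq _ UniformSpace.Completion.denseRange_coe
    (UniformSpace.Completion.isUniformInducing_coe V) v).symm

end SemiInnerProduct

theorem exists_representation_of_sesqForm {V : Type u} [AddCommGroup V] [Module ℂ V]
    {s : V →ₗ⋆[ℂ] V →ₗ[ℂ] ℂ} (hs : ∀ v, 0 ≤ s v v) (T : A →ₙₐ[ℂ] Module.End ℂ V)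
    (hT : ∀ x v w, s (T (star x) v) w = s v (T x w))
    (φ : V →ₗ[ℂ] ℂ) {C : ℝ} (hφ : ∀ v, ‖φ v‖ ^ 2 ≤ C * (s v v).re) :
    ∃ (H : Type u) (_ : NormedAddCommGroup H) (_ : InnerProductSpace ℂ H) (_ : CompleteSpace H)
      (j : V →ₗ[ℂ] H) (π : A →⋆ₙₐ[ℂ] (H →L[ℂ] H)) (ζ : H), DenseRange j ∧
      (∀ v w, inner ℂ (j v) (j w) = s v w) ∧ (∀ x v, π x (j v) = j (T x v)) ∧
      ∀ v, φ v = inner ℂ ζ (j v) := by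
  let core := preInnerProductSpaceCore hs
  let : SeminormedAddCommGroup V := InnerProductSpace.Core.toSeminormedAddCommGroup (c := core)
  let : InnerProductSpace ℂ V := InnerProductSpace.ofCore core
  have norm_sq (v : V) : ‖v‖ ^ 2 = (s v v).re := norm_sq_eq_re_inner (𝕜 := ℂ) v
  have hφ' (v : V) : ‖φ v‖ ≤ √C * ‖v‖ := by
    rw [← Real.sqrt_sq (norm_nonneg v), ← Real.sqrt_mul' _ (sq_nonneg _), norm_sq]
    exact Real.le_sqrt_of_sq_le (hφ v)
  obtain ⟨π, hπ⟩ := exists_completion_representation T hT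
  obtain ⟨ζ, hζ⟩ := exists_eq_inner_completion (φ.mkContinuous _ hφ')
  exact ⟨UniformSpace.Completion V, inferInstance, inferInstance, inferInstance,
    (UniformSpace.Completion.toComplL : V →L[ℂ] _).toLinearMap, π, ζ,
    UniformSpace.Completion.denseRange_coe, UniformSpace.Completion.inner_coe, hπ, hζ⟩

end PreHilbertRepresentations

section LeftIdeals

variable {A : Type u} [NonUnitalNormedRing A] [NormedSpace ℂ A]
  [IsScalarTower ℂ A A] [SMulCommClass ℂ A A] {M : Submodule ℂ A}

/-- Left multiplication on a left ideal, as a representation of the algebra. -/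
def IsLeftIdeal.mulLeft (hM : IsLeftIdeal M) : A →ₙₐ[ℂ] Module.End ℂ M where
  toFun x := (LinearMap.mulLeft ℂ x).restrict (hM x)
  map_smul' c x := LinearMap.ext fun a => Subtype.ext (smul_mul_assoc c x (a : A))
  map_zero' := LinearMap.ext fun a => Subtype.ext (zero_mul (a : A))
  map_add' x y := LinearMap.ext fun a => Subtype.ext (add_mul x y (a : A))
  map_mul' x y := LinearMap.ext fun a => Subtype.ext (mul_assoc x y (a : A))

theorem IsLeftIdeal.coe_mulLeft (hM : IsLeftIdeal M) (x : A) (a : M) :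
    (hM.mulLeft x a : A) = x * a := rfl

variable [StarRing A]

/-- `f` is the vector functional of `ζ` on the left ideal `M`, and `π(M)ζ` is dense, as in the
Gelfand–Naimark–Segal construction on `M`. The vector `ζ` need not be of the form `π a ζ`. -/
structure IsGNSPair (f : M →ₗ[ℂ] ℂ) {H : Type*} [NormedAddCommGroup H] [InnerProductSpace ℂ H]
    [CompleteSpace H] (π : A →⋆ₙₐ[ℂ] (H →L[ℂ] H)) (ζ : H) : Prop where
  dense : Dense ((fun x => π x ζ) '' M)
  apply_eq (a : M) : f a = inner ℂ ζ (π a ζ)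

variable [StarModule ℂ A]

/-- The sesquilinear form `(a, b) ↦ f (a* b)` on a left ideal. -/
def IsLeftIdeal.sesqForm (hM : IsLeftIdeal M) (f : M →ₗ[ℂ] ℂ) : M →ₗ⋆[ℂ] M →ₗ[ℂ] ℂ :=
  LinearMap.mk₂'ₛₗ (starRingEnd ℂ) (RingHom.id ℂ) (fun a b => f (hM.mulLeft (star (a : A)) b))
    (fun a b c => by simp) (fun k a b => by simp) (fun a b c => by simp) (fun k a b => by simp)

theorem IsLeftIdeal.sesqForm_apply (hM : IsLeftIdeal M) (f : M →ₗ[ℂ] ℂ) (a b : M) :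
    hM.sesqForm f a b = f (hM.mulLeft (star (a : A)) b) := rfl

theorem IsLeftIdeal.sesqForm_mulLeft_star (hM : IsLeftIdeal M) (f : M →ₗ[ℂ] ℂ) (x : A) (a b : M) :
    hM.sesqForm f (hM.mulLeft (star x) a) b = hM.sesqForm f a (hM.mulLeft x b) := by
  rw [sesqForm_apply, sesqForm_apply, coe_mulLeft, star_mul, star_star, map_mul]
  rfl

theorem IsLeftIdeal.sesqForm_apply_self_nonneg (hM : IsLeftIdeal M) {f : M →ₗ[ℂ] ℂ} {C : ℝ}
    (hC : 0 ≤ C) (hf : ∀ a : M, ((‖f a‖ ^ 2 : ℝ) : ℂ) ≤ (C : ℂ) * hM.sesqForm f a a) (a : M) :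
    0 ≤ hM.sesqForm f a a := by
  rcases hC.eq_or_lt with rfl | hC
  · have h0 (b : M) : f b = 0 := by
      have := hf b
      rw [Complex.ofReal_zero, zero_mul] at this
      exact norm_eq_zero.1 (pow_eq_zero_iff two_ne_zero |>.1
        (le_antisymm (by exact_mod_cast this) (sq_nonneg ‖f b‖)))
    rw [sesqForm_apply, h0]
  · have h : 0 ≤ (C : ℂ) * hM.sesqForm f a a :=
      (Complex.zero_le_real.2 (sq_nonneg ‖f a‖)).trans (hf a)
    have hC' : (C : ℂ) ≠ 0 := by exact_mod_cast hC.ne'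
    have hinv : (0 : ℂ) ≤ (C : ℂ)⁻¹ := by exact_mod_cast inv_nonneg.2 hC.le
    simpa only [inv_mul_cancel_left₀ hC'] using mul_nonneg hinv h

theorem exists_isGNSPair [CompleteSpace A] (hM : IsLeftIdeal M) (f : M →ₗ[ℂ] ℂ) {C : ℝ}
    (hC : 0 ≤ C) (hf : ∀ a : M, ((‖f a‖ ^ 2 : ℝ) : ℂ) ≤ (C : ℂ) * hM.sesqForm f a a) :
    ∃ (H : Type u) (_ : NormedAddCommGroup H) (_ : InnerProductSpace ℂ H) (_ : CompleteSpace H)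
      (π : A →⋆ₙₐ[ℂ] (H →L[ℂ] H)) (ζ : H), IsGNSPair f π ζ := by
  have hpos := hM.sesqForm_apply_self_nonneg hC hf
  obtain ⟨H, _, _, _, j, π, ζ, hj, hinner, hπ, hζ⟩ := exists_representation_of_sesqForm hpos
    hM.mulLeft (hM.sesqForm_mulLeft_star f) f (C := C) fun a => by
      simpa only [Complex.ofReal_re, Complex.re_ofReal_mul] using (Complex.le_def.1 (hf a)).1
  have hπζ (a : M) : π a ζ = j a := by
    refine hj.eq_of_inner_right ℂ fun b => ?_
    calc inner ℂ (j b) (π a ζ) = inner ℂ (π (star (a : A)) (j b)) ζ := by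
          rw [map_star, ContinuousLinearMap.star_eq_adjoint,
            ContinuousLinearMap.adjoint_inner_left]
      _ = inner ℂ (j b) (j a) := by
          rw [hπ, ← inner_conj_symm, ← hζ, ← hM.sesqForm_apply, sesqForm_conj_symm hpos, hinner]
  refine ⟨H, _, _, _, π, ζ, ?_, fun a => (hζ a).trans (by rw [hπζ])⟩
  rw [Set.image_eq_range]
  simp only [hπζ]
  exact hj

end LeftIdeals

section VectorFunctionals

variable {A : Type u} [NonUnitalNormedRing A] [NormedSpace ℂ A]
  [IsScalarTower ℂ A A] [SMulCommClass ℂ A A] [CompleteSpace A] [StarRing A] [StarModule ℂ A]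

section Representations

variable {H : Type*} [NormedAddCommGroup H] [InnerProductSpace ℂ H] [CompleteSpace H]
  (π : A →⋆ₙₐ[ℂ] (H →L[ℂ] H)) (ζ : H)

omit [CompleteSpace A] [IsScalarTower ℂ A A] [SMulCommClass ℂ A A] [StarModule ℂ A] in
theorem inner_map_star_mul (x y : A) (v w : H) :
    inner ℂ v (π (star y * x) w) = inner ℂ (π y v) (π x w) := by
  rw [map_mul, map_star, ContinuousLinearMap.star_eq_adjoint, mul_apply_eq_comp,
    ContinuousLinearMap.adjoint_inner_right]

/-- A representation as a bounded linear map, by automatic continuity. -/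
noncomputable def representationCLM : A →L[ℂ] H →L[ℂ] H :=
  ⟨LinearMapClass.linearMap π, continuous_starHom_to_cstarAlgebra π⟩

/-- The orbit map `x ↦ π x ζ` of a vector. -/
noncomputable def orbitMap : A →L[ℂ] H :=
  (representationCLM π).flip ζ

theorem orbitMap_apply (x : A) : orbitMap π ζ x = π x ζ := rfl

/-- The vector functional `x ↦ ⟪ζ, π x ζ⟫`. -/
noncomputable def vectorFunctional : StrongDual ℂ A :=
  (antidualAdjoint (orbitMap π ζ) ζ).conj

theorem vectorFunctional_apply (x : A) : vectorFunctional π ζ x = inner ℂ ζ (π x ζ) :=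
  inner_conj_symm ζ (π x ζ)

theorem vectorFunctional_star_mul (x y : A) :
    vectorFunctional π ζ (star y * x) = inner ℂ (π y ζ) (π x ζ) := by
  rw [vectorFunctional_apply, inner_map_star_mul]

/-- The operator `x ↦ (y ↦ ⟪π y ζ, π x ζ⟫)`, i.e. `V† V` for the orbit map `V`. -/
noncomputable def gramOperator : A →L[ℂ] AntiDual A :=
  (antidualAdjoint (orbitMap π ζ)).comp (orbitMap π ζ)

theorem gramOperator_apply (x y : A) :
    gramOperator π ζ x y = vectorFunctional π ζ (star y * x) :=
  (vectorFunctional_star_mul π ζ x y).symm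

theorem isPositiveOp_gramOperator : IsPositiveOp (gramOperator π ζ) :=
  isPositiveOp_antidualAdjoint_comp _

theorem norm_vectorFunctional_sq_le (x : A) :
    ‖vectorFunctional π ζ x‖ ^ 2 ≤ ‖ζ‖ ^ 2 * (vectorFunctional π ζ (star x * x)).re := by
  rw [vectorFunctional_star_mul, inner_self_eq_ofReal_norm_sq, Complex.ofReal_re, ← mul_pow,
    vectorFunctional_apply]
  gcongr
  exact norm_inner_le_norm ζ (π x ζ)

/-- The cyclic subspace reduces `π`, and `π` annihilates the component of `ζ` orthogonal to it. -/
theorem exists_mem_closure_range_map_eq :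
    ∃ η ∈ (orbitMap π ζ).range.topologicalClosure, ∀ x, π x η = π x ζ := by
  set K := (orbitMap π ζ).range.topologicalClosure
  have orbit_mem (x : A) : π x ζ ∈ K := Submodule.le_topologicalClosure _ ⟨x, rfl⟩
  have hK (x : A) {v : H} (hv : v ∈ K) : π x v ∈ K := by
    refine map_mem_closure (π x).continuous hv ?_
    rintro _ ⟨y, rfl⟩
    exact ⟨x * y, by simp [orbitMap_apply]⟩
  obtain ⟨η, hη, δ, hδ, hsum⟩ := K.exists_add_mem_mem_orthogonal ζ
  refine ⟨η, hη, fun x => ?_⟩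
  have hδK : π (star x * x) δ ∈ K := by
    rw [← add_sub_cancel_left η δ, ← hsum, map_sub]
    exact K.sub_mem (orbit_mem _) (hK _ hη)
  have hδ0 : π x δ = 0 := by
    rw [← inner_self_eq_zero (𝕜 := ℂ), ← inner_map_star_mul]
    exact K.inner_left_of_mem_orthogonal hδK hδ
  rw [hsum, map_add, hδ0, add_zero]

theorem exists_seq_tendsto_map_sub_mul :
    ∃ a : ℕ → A, ∀ x, Tendsto (fun n => π (x - x * a n) ζ) atTop (𝓝 0) := by
  obtain ⟨η, hη, hπη⟩ := exists_mem_closure_range_map_eq π ζ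
  obtain ⟨v, hv, hlim⟩ := mem_closure_iff_seq_limit.1 hη
  choose a ha using hv
  refine ⟨a, fun x => ?_⟩
  have hsub (n : ℕ) : π (x - x * a n) ζ = π x ζ - π x (v n) := by
    rw [map_sub, map_mul, ← ha]; rfl
  simpa only [hsub, hπη, sub_self, Function.comp_apply] using
    (((π x).continuous.tendsto η).comp hlim).const_sub (π x ζ)

end Representations

variable {g g' : StrongDual ℂ A}

theorem isRepresentable_iff : IsRepresentable g ↔
    ∃ (H : Type u) (_ : NormedAddCommGroup H) (_ : InnerProductSpace ℂ H) (_ : CompleteSpace H)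
      (π : A →⋆ₙₐ[ℂ] (H →L[ℂ] H)) (ζ : H), g = vectorFunctional π ζ := by
  constructor
  · rintro ⟨-, H, _, _, _, π, ζ, h⟩
    exact ⟨H, _, _, _, π, ζ, ContinuousLinearMap.ext fun x => by rw [h, vectorFunctional_apply]⟩
  · rintro ⟨H, _, _, _, π, ζ, rfl⟩
    refine ⟨fun x => ?_, H, _, _, _, π, ζ, vectorFunctional_apply π ζ⟩
    rw [← gramOperator_apply]
    exact isPositiveOp_gramOperator π ζ x

theorem IsRepresentable.exists_isPositiveOp (hg : IsRepresentable g) :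
    ∃ B : A →L[ℂ] AntiDual A, IsPositiveOp B ∧ ∀ x y, B x y = g (star y * x) := by
  obtain ⟨H, _, _, _, π, ζ, rfl⟩ := isRepresentable_iff.1 hg
  exact ⟨gramOperator π ζ, isPositiveOp_gramOperator π ζ, gramOperator_apply π ζ⟩

theorem IsRepresentable.tendsto_zero (hg : IsRepresentable g) {ι : Type*} {l : Filter ι}
    {x : ι → A} (hx : Tendsto (fun i => g (star (x i) * x i)) l (𝓝 0)) :
    Tendsto (fun i => g (x i)) l (𝓝 0) := by
  obtain ⟨H, _, _, _, π, ζ, rfl⟩ := isRepresentable_iff.1 hg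
  have hsq : Tendsto (fun i => ‖vectorFunctional π ζ (x i)‖ ^ 2) l (𝓝 0) := by
    refine squeeze_zero (fun i => sq_nonneg _) (fun i => norm_vectorFunctional_sq_le π ζ (x i)) ?_
    simpa using ((Complex.continuous_re.tendsto 0).comp hx).const_mul (‖ζ‖ ^ 2)
  rw [tendsto_zero_iff_norm_tendsto_zero]
  simpa using hsq.sqrt

theorem IsRepresentable.exists_seq_tendsto (hg : IsRepresentable g) :
    ∃ a : ℕ → A, ∀ x,
      Tendsto (fun n => g (star (x - x * a n) * (x - x * a n))) atTop (𝓝 0) := by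
  obtain ⟨H, _, _, _, π, ζ, rfl⟩ := isRepresentable_iff.1 hg
  obtain ⟨a, ha⟩ := exists_seq_tendsto_map_sub_mul π ζ
  refine ⟨a, fun x => ?_⟩
  simpa only [vectorFunctional_star_mul, inner_zero_left] using (ha x).inner (𝕜 := ℂ) (ha x)

theorem IsRepresentable.ext (hg : IsRepresentable g) (hg' : IsRepresentable g')
    (h : ∀ x, g (star x * x) = g' (star x * x)) : g = g' := by
  obtain ⟨B, -, hB⟩ := hg.exists_isPositiveOp
  obtain ⟨B', -, hB'⟩ := hg'.exists_isPositiveOp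
  have hBB' : B = B' := operator_ext_of_apply_self fun x => by rw [hB, hB', h]
  have hmul (x y : A) : g (x * y) = g' (x * y) := by
    rw [← star_star x, ← hB, ← hB', hBB']
  obtain ⟨a, ha⟩ := hg.exists_seq_tendsto
  ext x
  have hlim := hg.tendsto_zero (ha x)
  have hlim' := hg'.tendsto_zero (by simpa only [h] using ha x)
  simp only [map_sub, hmul] at hlim hlim'
  have hsub := hlim.sub hlim'
  simp only [sub_sub_sub_cancel_right, sub_zero] at hsub
  exact sub_eq_zero.1 (tendsto_nhds_unique tendsto_const_nhds hsub)

theorem IsMinimalRepresentableExtension.unique {M : Submodule ℂ A} {f : M →ₗ[ℂ] ℂ}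
    (hg : IsMinimalRepresentableExtension f g) (hg' : IsMinimalRepresentableExtension f g') :
    g = g' :=
  hg.1.1.ext hg'.1.1 fun x => le_antisymm (hg.2 _ hg'.1 x) (hg'.2 _ hg.1 x)

end VectorFunctionals

section ExtensionsOfLeftIdealFunctionals

variable {A : Type u} [NonUnitalNormedRing A] [NormedSpace ℂ A] [IsScalarTower ℂ A A]
  [SMulCommClass ℂ A A] [CompleteSpace A] [StarRing A] [StarModule ℂ A]
  {M : Submodule ℂ A} {f : M →ₗ[ℂ] ℂ}
  {H : Type*} [NormedAddCommGroup H] [InnerProductSpace ℂ H] [CompleteSpace H]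
  {π : A →⋆ₙₐ[ℂ] (H →L[ℂ] H)} {ζ : H}

omit [CompleteSpace A] [StarModule ℂ A] in
theorem IsGNSPair.apply_mulLeft_star (h : IsGNSPair f π ζ) (hM : IsLeftIdeal M) (x : A) (a : M) :
    f (hM.mulLeft (star x) a) = inner ℂ (π x ζ) (π a ζ) := by
  rw [h.apply_eq, hM.coe_mulLeft, inner_map_star_mul]

theorem IsGNSPair.continuous_apply_star_mul (h : IsGNSPair f π ζ) (hM : IsLeftIdeal M) (a : M) :
    Continuous fun x : A => f (hM.mulLeft (star x) a) := by
  simp only [h.apply_mulLeft_star hM]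
  exact (antidualAdjoint (orbitMap π ζ) (π a ζ)).continuous

variable {hM : IsLeftIdeal M} {hcont : ∀ a : M, Continuous fun x : A => f (hM.mulLeft (star x) a)}

theorem IsGNSPair.isKreinVonNeumannExtension (h : IsGNSPair f π ζ) :
    IsKreinVonNeumannExtension (inducedOperator hM f hcont) (gramOperator π ζ) :=
  isKreinVonNeumannExtension_antidualAdjoint_comp h.dense fun a =>
    ContinuousLinearMap.ext fun x => h.apply_mulLeft_star hM x a

theorem IsRepresentableExtension.exists_isPositiveExtension {g : StrongDual ℂ A}
    (hg : IsRepresentableExtension f g) :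
    ∃ B, IsPositiveExtension (inducedOperator hM f hcont) B ∧ ∀ x y, B x y = g (star y * x) := by
  obtain ⟨B, hpos, hB⟩ := hg.1.exists_isPositiveOp
  refine ⟨B, ⟨hpos, fun a => ContinuousLinearMap.ext fun x => ?_⟩, hB⟩
  exact (hB a x).trans (hg.2 (hM.mulLeft (star x) a))

theorem IsGNSPair.tendsto_map_apply (h : IsGNSPair f π ζ) {ι : Type*} {l : Filter ι} {e : ι → A}
    (he_bdd : ∃ K : ℝ, ∀ i, ‖e i‖ ≤ K) (he : ∀ a ∈ M, Tendsto (fun i => e i * a) l (𝓝 a)) :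
    Tendsto (fun i => π (e i) ζ) l (𝓝 ζ) := by
  obtain ⟨K, hK⟩ := he_bdd
  have hequi : Equicontinuous fun i v => π (e i) v :=
    by
    refine ((NormedSpace.equicontinuous_TFAE fun i => representationCLM π (e i)).out 1 5).2 ?_
    exact ⟨_, fun i => (representationCLM π).le_of_opNorm_le_of_le le_rfl (hK i)⟩
  suffices ∀ v, Tendsto (fun i => π (e i) v) l (𝓝 v) from this ζ
  intro v
  induction v using h.dense.induction with
  | mem v hv =>
    obtain ⟨a, ha, rfl⟩ := hv
    have := ((orbitMap π ζ).continuous.tendsto a).comp (he a ha)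
    simpa only [Function.comp_def, orbitMap_apply, map_mul, mul_apply_eq_comp] using this
  | isClosed => exact hequi.isClosed_setOfPred_tendsto continuous_id

theorem IsGNSPair.tendsto_gramOperator (h : IsGNSPair f π ζ) {ι : Type*} {l : Filter ι} {e : ι → A}
    (he_bdd : ∃ K : ℝ, ∀ i, ‖e i‖ ≤ K) (he : ∀ a ∈ M, Tendsto (fun i => e i * a) l (𝓝 a)) :
    Tendsto (fun i => gramOperator π ζ (e i)) l (𝓝 (antidualAdjoint (orbitMap π ζ) ζ)) :=
  ((antidualAdjoint (orbitMap π ζ)).continuous.tendsto ζ).comp (h.tendsto_map_apply he_bdd he)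

end ExtensionsOfLeftIdealFunctionals

section MinimalExtension

variable {A : Type u} [NonUnitalNormedRing A] [NormedSpace ℂ A] [IsScalarTower ℂ A A]
  [SMulCommClass ℂ A A] [CompleteSpace A] [StarRing A] [StarModule ℂ A]
  {M : Submodule ℂ A} {f : M →ₗ[ℂ] ℂ}
  {H : Type u} [NormedAddCommGroup H] [InnerProductSpace ℂ H] [CompleteSpace H]
  {π : A →⋆ₙₐ[ℂ] (H →L[ℂ] H)} {ζ : H}

theorem IsGNSPair.isMinimalRepresentableExtension (h : IsGNSPair f π ζ) (hM : IsLeftIdeal M) :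
    IsMinimalRepresentableExtension f (vectorFunctional π ζ) := by
  refine ⟨⟨isRepresentable_iff.2 ⟨H, _, _, _, π, ζ, rfl⟩, fun a => ?_⟩, fun g hg x => ?_⟩
  · rw [vectorFunctional_apply, h.apply_eq]
  · obtain ⟨B, hB, hBg⟩ := hg.exists_isPositiveExtension (hM := hM)
      (hcont := h.continuous_apply_star_mul hM)
    rw [← gramOperator_apply, ← hBg]
    exact h.isKreinVonNeumannExtension.2 B hB x

end MinimalExtension

theorem theorem5p6_general {A : Type u} [NonUnitalNormedRing A] [NormedSpace ℂ A]
    [IsScalarTower ℂ A A] [SMulCommClass ℂ A A] [CompleteSpace A] [StarRing A] [StarModule ℂ A]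
    (M : Submodule ℂ A) (hM : IsLeftIdeal M) (f : M →ₗ[ℂ] ℂ) (C : ℝ) (hC : 0 ≤ C)
    (hf : ∀ a : M,
      ((‖f a‖ ^ 2 : ℝ) : ℂ) ≤ (C : ℂ) * f ⟨star (a : A) * a, hM (star (a : A)) a a.2⟩) :
    ∃ hcont : ∀ a : M, Continuous fun x : A => f ⟨star x * a, hM (star x) a a.2⟩,
      (∃! A_N : A →L[ℂ] AntiDual A,
        IsKreinVonNeumannExtension (inducedOperator hM f hcont) A_N) ∧
      (∃! f_N : StrongDual ℂ A, IsMinimalRepresentableExtension f f_N) ∧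
      ∀ {ι : Type*} (l : Filter ι) (e : ι → A), (∃ K : ℝ, ∀ i, ‖e i‖ ≤ K) →
        (∀ a ∈ M, Tendsto (fun i => e i * a) l (𝓝 a)) →
        ∀ (A_N : A →L[ℂ] AntiDual A) (f_N : StrongDual ℂ A),
          IsKreinVonNeumannExtension (inducedOperator hM f hcont) A_N →
          IsMinimalRepresentableExtension f f_N →
          (∃ φ : AntiDual A, Tendsto (fun i => A_N (e i)) l (𝓝 φ) ∧ f_N = φ.conj) ∧
          Tendsto (fun i => (A_N (e i)).conj) l (𝓝 f_N) := by
  obtain ⟨H, _, _, _, π, ζ, h⟩ := exists_isGNSPair hM f hC hf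
  have krein := h.isKreinVonNeumannExtension (hM := hM)
    (hcont := h.continuous_apply_star_mul hM)
  have minimal := h.isMinimalRepresentableExtension hM
  refine ⟨h.continuous_apply_star_mul hM, ⟨_, krein, fun _ hA => hA.unique krein⟩,
    ⟨_, minimal, fun _ hg => hg.unique minimal⟩, fun l e he_bdd he A_N f_N hA_N hf_N => ?_⟩
  obtain rfl := hA_N.unique krein
  obtain rfl := hf_N.unique minimal
  have lim := h.tendsto_gramOperator he_bdd he
  exact ⟨⟨_, lim, rfl⟩, (AntiDual.continuous_conj.tendsto _).comp lim⟩

theorem theorem5p6 {𝔄 : Type u} [NonUnitalNormedRing 𝔄] [NormedSpace ℂ 𝔄]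
    [IsScalarTower ℂ 𝔄 𝔄] [SMulCommClass ℂ 𝔄 𝔄] [CompleteSpace 𝔄] [StarRing 𝔄] [StarModule ℂ 𝔄]
    (M : Submodule ℂ 𝔄) (hM : IsLeftIdeal M) (f : M →ₗ[ℂ] ℂ)
    (C : ℝ) (hC : 0 ≤ C)
    (hf : ∀ a : M,
      ((‖f a‖ ^ 2 : ℝ) : ℂ) ≤ (C : ℂ) * f ⟨star (a : 𝔄) * a, hM (star (a : 𝔄)) a a.2⟩)
    {ι : Type*} [Preorder ι] [IsDirected ι (· ≤ ·)] [Nonempty ι]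
    (e : ι → 𝔄) (he_bdd : ∃ K : ℝ, ∀ i, ‖e i‖ ≤ K)
    (he : ∀ a ∈ M, Tendsto (fun i => e i * a) atTop (𝓝 a)) :
    ∃ hcont : ∀ a : M, Continuous fun x : 𝔄 => f ⟨star x * a, hM (star x) a a.2⟩,
      (∃! A_N : 𝔄 →L[ℂ] AntiDual 𝔄,
        IsKreinVonNeumannExtension (inducedOperator hM f hcont) A_N) ∧
      (∃! f_N : StrongDual ℂ 𝔄, IsMinimalRepresentableExtension f f_N) ∧
      ∀ (A_N : 𝔄 →L[ℂ] AntiDual 𝔄) (f_N : StrongDual ℂ 𝔄),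
        IsKreinVonNeumannExtension (inducedOperator hM f hcont) A_N →
        IsMinimalRepresentableExtension f f_N →
        (∃ φ : AntiDual 𝔄, Tendsto (fun i => A_N (e i)) atTop (𝓝 φ) ∧ f_N = φ.conj) ∧
        Tendsto (fun i => (A_N (e i)).conj) atTop (𝓝 f_N) := by
  obtain ⟨hcont, hA_N, hf_N, tendsto⟩ := theorem5p6_general M hM f C hC hf
  exact ⟨hcont, hA_N, hf_N, tendsto atTop e he_bdd he⟩
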